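/- Breakout in the plane: the bricks are the closed unit squares $[m,m+1]\times[n,n+1]$, $(m,n)\in\mathbb Z^2\setminus\{(-1,0)\}$. A ball is launched from $(0,y)$, $0<y<1$, towards the northeast with slope $S\in(0,1)$. It moves in a straight line until it touches a brick that is still present; that brick is destroyed and the ball is reflected by the edge it has hit. Only orbits that avoid $\mathbb Z^2$ are considered. The first brick hit is $[0,1]\times[0,1]$, on a vertical edge, at distance $0$. The symbolic orbit is the infinite word $\omega\in\{a,b\}^{\mathbb N}$ with $\omega_n=a$ if the $n$-th destroyed brick is hit on a horizontal edge and $\omega_n=b$ if it is hit on a vertical edge. Let $T_x(d)$ be the abscissa of the ball after it has travelled the horizontal distance $d$. For integers $0\le\rho\le\alpha$ put $|\alpha,\rho|=\frac{\alpha(\alpha+1)}2+\rho+1$ and $X(|\alpha,\rho|)=\sum_{0<n\le\alpha}(-1)^n n+(-1)^{\alpha+1}(\rho+1)$. A triple $\Delta=((\alpha_i,\rho_i))_{0\le i\le2}$ of such pairs is an elementary block if there are $S\in(0,1)$ and $y\in(0,S)$ with $i+1<y+|\alpha_i,\rho_i|S<i+1+S$ for $i=0,1,2$, and $\alpha_2-2\rho_2$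 equals $\alpha_0-2\rho_0$ if $\alpha_0,\alpha_2$ have the same parity and $-\alpha_0+2\rho_0+1$ otherwise. Its slices are $(|\alpha_0,\rho_0|,\ |\alpha_1,\rho_1|-|\alpha_0,\rho_0|,\ |\alpha_2,\rho_2|-|\alpha_1,\rho_1|)$. An orbit of slope $S$ with $0<y<S$ has elementary sequence $(\Delta_N)_{N\ge0}$, where the $\Delta_N=((\alpha_{i,N},\rho_{i,N}))_{0\le i\le2}$ are elementary blocks, if $$T_x(\Sigma_N+|\alpha_{i,N},\rho_{i,N}|)=T_x(\Sigma_N)+(-1)^{\alpha_N}X(|\alpha_{i,N},\rho_{i,N}|)\qquad(N\ge0,\ 0\le i\le2),$$ where $\Sigma_N=\sum_{j<N}|\alpha_{2,j},\rho_{2,j}|$ and $\alpha_N=\sum_{j<N}(\alpha_{2,j}+1)$. **Proposition.** A single symbolic orbit can be shared by an infinity of slopes. Explicitly, $\Lambda=((16,1),(22,22),(28,7))$ and $\Lambda_{0-}=((16,0),(22,21),(28,6))$ are elementary blocks with slices $(138,138,138)$ and $(137,138,138)$, and there is a single word $\omega\in\{a,b\}^{\mathbb N}$ such that 1. for every integer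 $J\ge1$ and every $y$ with $\frac2{3J\cdot138-1}<y<\frac3{3J\cdot138-1}$, an orbit of slope $\frac{3J}{3J\cdot138-1}$ launched from $(0,y)$ exists (it hits infinitely many bricks and avoids $\mathbb Z^2$), and every such orbit has symbolic orbit $\omega$ and the periodic elementary sequence $(\Lambda^{J-1}\Lambda_{0-})^\infty$; 2. the set of slopes $S\in(0,1)$ for which some orbit of slope $S$, launched from some $(0,y)$ with $0<y<1$, has symbolic orbit $\omega$ is infinite. -/

import Mathlib

namespace Breakout

/-! ### The breakout dynamics in the plane -/

/-- The closed unit brick whose lower left corner is `z`. -/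
def brick (z : ℤ × ℤ) : Set (ℝ × ℝ) :=
  Set.Icc (z.1 : ℝ) (z.1 + 1) ×ˢ Set.Icc (z.2 : ℝ) (z.2 + 1)

/-- The letters of symbolic orbits: `a` for a brick hit on a horizontal edge,
`b` for a brick hit on a vertical edge. -/
inductive Letter where
  | a
  | b

/-- The union of the two horizontal edges (letter `a`) or of the two vertical edges
(letter `b`) of the brick with lower left corner `z`. -/
def edges : Letter → ℤ × ℤ → Set (ℝ × ℝ)
  | Letter.a, z =>
      {p | p.1 ∈ Set.Icc (z.1 : ℝ) (z.1 + 1) ∧ (p.2 = (z.2 : ℝ) ∨ p.2 = (z.2 : ℝ) + 1)}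
  | Letter.b, z =>
      {p | (p.1 = (z.1 : ℝ) ∨ p.1 = (z.1 : ℝ) + 1) ∧ p.2 ∈ Set.Icc (z.2 : ℝ) (z.2 + 1)}

/-- The change of the direction vector when the ball bounces off a horizontal (`a`) or
vertical (`b`) edge. -/
def bounce : Letter → ℝ × ℝ → ℝ × ℝ
  | Letter.a, v => (v.1, -v.2)
  | Letter.b, v => (-v.1, v.2)

/-- A state of the game: position and direction vector of the ball, the horizontal distance
travelled so far, and the bricks that are still present. -/
structure State where
  pos : ℝ × ℝ
  dir : ℝ × ℝ
  dist : ℝ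
  bricks : Set (ℤ × ℤ)

/-- The ball is launched from `(0, y)` towards the northeast with slope `S`;
all bricks are present, except the one at `(-1, 0)`. -/
def initialState (S y : ℝ) : State where
  pos := (0, y)
  dir := (1, S)
  dist := 0
  bricks := {(-1, 0)}ᶜ

/-- From the state `s` the ball flies in a straight line, without meeting a point of `ℤ²`,
until it first touches a brick that is still present (possibly immediately); this is the
brick `z`, hit on an edge of type `e`. The brick is destroyed, the ball bounces, and the new
state is `s'`. -/
def Step (s : State) (z : ℤ × ℤ) (e : Letter) (s' : State) : Prop :=
  ∃ t : ℝ,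
    IsLeast {u : ℝ | 0 ≤ u ∧ ∃ w ∈ s.bricks, s.pos + u • s.dir ∈ brick w} t ∧
    (∀ u ∈ Set.Icc 0 t, ∀ m n : ℤ, s.pos + u • s.dir ≠ ((m : ℝ), (n : ℝ))) ∧
    z ∈ s.bricks ∧
    s.pos + t • s.dir ∈ edges e z ∧
    s'.pos = s.pos + t • s.dir ∧
    s'.dir = bounce e s.dir ∧
    s'.dist = s.dist + t * |s.dir.1| ∧
    s'.bricks = s.bricks \ {z}

/-- An infinite breakout orbit of slope `S` launched from `(0, y)`. The `n`-th brick destroyed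
is `hit n`, on an edge of type `symbolicOrbit n`; `state n` is the state just before the flight
that leads to it. -/
structure Orbit (S y : ℝ) where
  state : ℕ → State
  hit : ℕ → ℤ × ℤ
  symbolicOrbit : ℕ → Letter
  start : state 0 = initialState S y
  step : ∀ n, Step (state n) (hit n) (symbolicOrbit n) (state (n + 1))

/-- After travelling the horizontal distance `d`, the ball has abscissa `x`.
(All direction vectors occurring in the orbit have first coordinate `1` or `-1`.) -/
def Orbit.HasAbscissa {S y : ℝ} (o : Orbit S y) (d x : ℝ) : Prop :=
  ∃ n, (o.state n).dist ≤ d ∧ d ≤ (o.state (n + 1)).dist ∧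
    x = (o.state n).pos.1 + (d - (o.state n).dist) * (o.state n).dir.1

/-! ### Ternary and elementary blocks -/

/-- The integer `|α, ρ| = α (α + 1) / 2 + (ρ + 1)`. -/
def len (c : ℕ × ℕ) : ℕ := c.1 * (c.1 + 1) / 2 + (c.2 + 1)

/-- The integer `X(|α, ρ|)`. -/
def absc (c : ℕ × ℕ) : ℤ :=
  (∑ n ∈ Finset.Ioc 0 c.1, (-1 : ℤ) ^ n * (n : ℤ)) + (-1) ^ (c.1 + 1) * ((c.2 : ℤ) + 1)

/-- The slope `S` is primary for `((α₀, ρ₀), (α₁, ρ₁), (α₂, ρ₂))`: along some line of slope `S`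
and initial ordinate `y` in `(0, S)`, the first three horizontal lines are crossed just before
the horizontal distances `|α₀, ρ₀|`, `|α₁, ρ₁|`, `|α₂, ρ₂|`. -/
def IsPrimary (S : ℝ) (Δ : Fin 3 → ℕ × ℕ) : Prop :=
  ∃ y : ℝ, 0 < y ∧ y < S ∧ ∀ i : Fin 3,
    ((i : ℕ) : ℝ) + 1 < y + S * (len (Δ i) : ℝ) ∧
      y + S * (len (Δ i) : ℝ) < ((i : ℕ) : ℝ) + 1 + S

/-- Ternary blocks. -/
def IsTernaryBlock (Δ : Fin 3 → ℕ × ℕ) : Prop :=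
  (∀ i, (Δ i).2 < (Δ i).1 + 1) ∧ ∃ S : ℝ, 0 < S ∧ S < 1 ∧ IsPrimary S Δ

/-- Elementary blocks. -/
def IsElementaryBlock (Δ : Fin 3 → ℕ × ℕ) : Prop :=
  IsTernaryBlock Δ ∧
    ((Δ 0).1 ≡ (Δ 2).1 [MOD 2] →
      ((Δ 2).1 : ℤ) - 2 * (Δ 2).2 = ((Δ 0).1 : ℤ) - 2 * (Δ 0).2) ∧
    (¬ (Δ 0).1 ≡ (Δ 2).1 [MOD 2] →
      ((Δ 2).1 : ℤ) - 2 * (Δ 2).2 = -((Δ 0).1 : ℤ) + 2 * (Δ 0).2 + 1)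

/-- The notation `(χ₀, χ₁, χ₂)` of a block through the elements of the slicing sequence. -/
def slices (Δ : Fin 3 → ℕ × ℕ) : ℤ × ℤ × ℤ :=
  ((len (Δ 0) : ℤ), (len (Δ 1) : ℤ) - len (Δ 0), (len (Δ 2) : ℤ) - len (Δ 1))

/-- The orbit goes successively through the elementary blocks `Δ 0, Δ 1, Δ 2, …`. -/
def Orbit.HasElementarySequence {S y : ℝ} (o : Orbit S y) (Δ : ℕ → Fin 3 → ℕ × ℕ) : Prop :=
  0 < y ∧ y < S ∧ (∀ N, IsElementaryBlock (Δ N)) ∧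
    ∀ (N : ℕ) (i : Fin 3), ∃ x x' : ℝ,
      o.HasAbscissa ((∑ j ∈ Finset.range N, len (Δ j 2) : ℕ) : ℝ) x ∧
      o.HasAbscissa (((∑ j ∈ Finset.range N, len (Δ j 2)) + len (Δ N i) : ℕ) : ℝ) x' ∧
      x' = x + (-1) ^ (∑ j ∈ Finset.range N, ((Δ j 2).1 + 1)) * (absc (Δ N i) : ℝ)

/-- The block `Λ = ((16, 1), (22, 22), (28, 7))`. -/
def blockΛ : Fin 3 → ℕ × ℕ := ![(16, 1), (22, 22), (28, 7)]

/-- The block `Λ₀₋ = ((16, 0), (22, 21), (28, 6))`. -/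
def blockΛ₀ : Fin 3 → ℕ × ℕ := ![(16, 0), (22, 21), (28, 6)]

/-- The periodic sequence of blocks with period `Λ^(J-1) Λ₀₋`. -/
def blockSequence (J N : ℕ) : Fin 3 → ℕ × ℕ := if J ∣ N + 1 then blockΛ₀ else blockΛ

end Breakout

/-! Inside a row the ball bounces between two walls that each hit moves back by one unit, so the
`k`-th side hit occurs at horizontal distance `tri k` = k(k+1)/2 after the first. Vertical
reflections are unfolded: after distance T in the row `N` the height is `V N + S * T`, and reaching
1, 2, 3 means crossing a border of the row. The first crossing opens a hole in the row above, the
second destroys a brick of the row below, and the third meets the hole again; the ball passes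
through and hits the side of the next brick. It then sits in row `N + 1` between an empty cell and a
destroyed brick, the situation in which row `N` began.

An `Itinerary` requires the crossings to occur in the unit intervals ending at 138(i+1) - δ with δ
equal to 0 or 1. Since `tri 16` = 136, `tri 22` = 253 and `tri 28` = 406, they follow the side hits
16, 22 and 28 for either value of δ. Hence every row contributes b¹⁷ab⁶ab⁶: δ changes the bricks
that are hit but not the letters.

For S = 3J/D with D = 414J - 1, a row with δ = 0 raises the entrance height by 414S - 3 = 3/D, and
one with δ = 1 lowers it by 3(J-1)/D. Taking δ = 1 once every J rows makes the heights periodic, so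
all these slopes share `word`. The carrying lemmas are `FirstTouch.step_iff`,
`Itinerary.advances_stateAt`, `Itinerary.hasElementarySequence` and the construction
`slopeItinerary`. -/

namespace Breakout

/-! ### First touches determine the next step -/

/-- The ball in the state `s` first touches a brick after the time `t`; the only brick touched
is `z`, on an edge of type `e`. -/
structure FirstTouch (s : State) (z : ℤ × ℤ) (e : Letter) (t : ℝ) : Prop where
  nonneg : 0 ≤ t
  free : ∀ u, 0 ≤ u → u < t → ∀ w ∈ s.bricks, s.pos + u • s.dir ∉ brick w
  avoid : ∀ u, 0 ≤ u → u ≤ t → ∀ m n : ℤ, s.pos + u • s.dir ≠ ((m : ℝ), (n : ℝ))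
  mem : z ∈ s.bricks
  edge : s.pos + t • s.dir ∈ edges e z
  only : ∀ w ∈ s.bricks, s.pos + t • s.dir ∈ brick w → w = z

/-- The state after the ball has flown for the time `t` and hit the brick `z`. -/
def nextState (s : State) (z : ℤ × ℤ) (e : Letter) (t : ℝ) : State where
  pos := s.pos + t • s.dir
  dir := bounce e s.dir
  dist := s.dist + t * |s.dir.1|
  bricks := s.bricks \ {z}

theorem edges_subset_brick (e : Letter) (z : ℤ × ℤ) : edges e z ⊆ brick z := by
  rintro p hp
  cases e with
  | a =>
    obtain ⟨h1, h2⟩ := hp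
    refine ⟨h1, ?_⟩
    rcases h2 with h | h <;> constructor <;> rw [h] <;> linarith
  | b =>
    obtain ⟨h1, h2⟩ := hp
    refine ⟨?_, h2⟩
    rcases h1 with h | h <;> constructor <;> rw [h] <;> linarith

theorem lattice_of_mem_edges {p : ℝ × ℝ} {e e' : Letter} {z z' : ℤ × ℤ} (h : p ∈ edges e z)
    (h' : p ∈ edges e' z') (hne : e ≠ e') : ∃ m n : ℤ, p = ((m : ℝ), (n : ℝ)) := by
  have key : ∀ {z z' : ℤ × ℤ}, p ∈ edges Letter.a z → p ∈ edges Letter.b z' →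
      ∃ m n : ℤ, p = ((m : ℝ), (n : ℝ)) := by
    rintro z z' ⟨-, h2⟩ ⟨h1, -⟩
    have hx : ∃ m : ℤ, p.1 = m := by
      rcases h1 with h | h
      · exact ⟨_, h⟩
      · exact ⟨z'.1 + 1, by rw [h]; push_cast; rfl⟩
    have hy : ∃ n : ℤ, p.2 = n := by
      rcases h2 with h | h
      · exact ⟨_, h⟩
      · exact ⟨z.2 + 1, by rw [h]; push_cast; rfl⟩
    obtain ⟨m, hm⟩ := hx
    obtain ⟨n, hn⟩ := hy
    exact ⟨m, n, Prod.ext hm hn⟩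
  cases e <;> cases e'
  · exact absurd rfl hne
  · exact key h h'
  · exact key h' h
  · exact absurd rfl hne

/-- The least time is unique, `only` fixes the brick, and two different letters would put the
contact point on a horizontal and a vertical edge, hence at a lattice point. -/
theorem FirstTouch.step_iff {s : State} {z : ℤ × ℤ} {e : Letter} {t : ℝ}
    (h : FirstTouch s z e t) (z' : ℤ × ℤ) (e' : Letter) (s' : State) :
    Step s z' e' s' ↔ z' = z ∧ e' = e ∧ s' = nextState s z e t := by
  have hleast : IsLeast {u : ℝ | 0 ≤ u ∧ ∃ w ∈ s.bricks, s.pos + u • s.dir ∈ brick w} t := by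
    refine ⟨⟨h.nonneg, z, h.mem, edges_subset_brick e z h.edge⟩, ?_⟩
    rintro u ⟨hu, w, hw, hm⟩
    by_contra! hlt
    exact h.free u hu hlt w hw hm
  constructor
  · rintro ⟨t', ht', -, hz', he', h1, h2, h3, h4⟩
    obtain rfl : t' = t := ht'.unique hleast
    obtain rfl : z' = z := h.only z' hz' (edges_subset_brick e' z' he')
    have hee : e' = e := by
      by_contra hne
      obtain ⟨m, n, hmn⟩ := lattice_of_mem_edges he' h.edge hne
      exact h.avoid t' h.nonneg le_rfl m n hmn
    subst hee
    refine ⟨rfl, rfl, ?_⟩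
    cases s'
    simp only [nextState, State.mk.injEq]
    exact ⟨h1, h2, h3, h4⟩
  · rintro ⟨rfl, rfl, rfl⟩
    exact ⟨t, hleast, fun u hu => h.avoid u hu.1 hu.2, h.mem, h.edge, rfl, rfl, rfl, rfl⟩

/-! ### Frames -/

/-- The unit interval `[cell X σ q, cell X σ q + 1]` is the image of `[q, q + 1]` under
`ξ ↦ X + σ ξ`, where `σ = ± 1`. -/
def cell (X σ q : ℤ) : ℤ := X + σ * q + (σ - 1) / 2

theorem cell_one (X q : ℤ) : cell X 1 q = X + q := by simp [cell]

theorem cell_neg_one (X q : ℤ) : cell X (-1) q = X - q - 1 := by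
  have : ((-1 : ℤ) - 1) / 2 = -1 := by norm_num
  simp only [cell, this]; ring

theorem cell_shift (X σ m q : ℤ) : cell (X + σ * m) σ q = cell X σ (m + q) := by
  simp only [cell]; ring

/-- The reflection ξ ↦ m - ξ carries [q, q+1] to [m-1-q, m-q]. -/
theorem cell_flip {σ : ℤ} (hσ : σ = 1 ∨ σ = -1) (X m q : ℤ) :
    cell (X + σ * m) (-σ) q = cell X σ (m - 1 - q) := by
  rcases hσ with rfl | rfl
  · rw [cell_neg_one, cell_one]; ring
  · rw [neg_neg, cell_neg_one, cell_one]; ring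

theorem cell_injective {σ : ℤ} (hσ : σ = 1 ∨ σ = -1) (X : ℤ) : Function.Injective (cell X σ) := by
  intro q q' h
  rcases hσ with rfl | rfl
  · rw [cell_one, cell_one] at h; omega
  · rw [cell_neg_one, cell_neg_one] at h; omega

theorem cell_surjective {σ : ℤ} (hσ : σ = 1 ∨ σ = -1) (X : ℤ) :
    Function.Surjective (cell X σ) := by
  intro c
  rcases hσ with rfl | rfl
  · exact ⟨c - X, by rw [cell_one]; ring⟩
  · exact ⟨X - c - 1, by rw [cell_neg_one]; ring⟩

theorem mem_Icc_cell {σ : ℤ} (hσ : σ = 1 ∨ σ = -1) (X q : ℤ) (ξ : ℝ) :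
    (X : ℝ) + σ * ξ ∈ Set.Icc (cell X σ q : ℝ) (cell X σ q + 1) ↔
      (q : ℝ) ≤ ξ ∧ ξ ≤ q + 1 := by
  rcases hσ with rfl | rfl
  · rw [cell_one, Set.mem_Icc]; push_cast
    constructor <;> rintro ⟨h1, h2⟩ <;> constructor <;> linarith
  · rw [cell_neg_one, Set.mem_Icc]; push_cast
    constructor <;> rintro ⟨h1, h2⟩ <;> constructor <;> linarith

theorem end_cell {σ : ℤ} (hσ : σ = 1 ∨ σ = -1) (X q : ℤ) :
    (X : ℝ) + σ * (q : ℝ) = (cell X σ q : ℝ) ∨ (X : ℝ) + σ * (q : ℝ) = (cell X σ q : ℝ) + 1 := by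
  rcases hσ with rfl | rfl
  · left; rw [cell_one]; push_cast; ring
  · right; rw [cell_neg_one]; push_cast; ring

theorem mem_brick_cell {σ τ : ℤ} (hσ : σ = 1 ∨ σ = -1) (hτ : τ = 1 ∨ τ = -1) (X Y q r : ℤ)
    (ξ v : ℝ) : ((X : ℝ) + σ * ξ, (Y : ℝ) + τ * v) ∈ brick (cell X σ q, cell Y τ r) ↔
      ((q : ℝ) ≤ ξ ∧ ξ ≤ q + 1) ∧ ((r : ℝ) ≤ v ∧ v ≤ r + 1) := by
  rw [brick, Set.mem_prod]
  exact and_congr (mem_Icc_cell hσ X q ξ) (mem_Icc_cell hτ Y r v)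

theorem int_of_frame {σ : ℤ} (hσ : σ = 1 ∨ σ = -1) {X m : ℤ} {ξ : ℝ} (h : (X : ℝ) + σ * ξ = m) :
    ∃ k : ℤ, ξ = k := by
  rcases hσ with rfl | rfl
  · exact ⟨m - X, by push_cast at h ⊢; linarith⟩
  · exact ⟨X - m, by push_cast at h ⊢; linarith⟩

theorem not_int_of_between {a k : ℤ} {x : ℝ} (h1 : (a : ℝ) < x) (h2 : x < a + 1)
    (h : x = (k : ℝ)) : False := by
  rw [h] at h1 h2
  have h3 : a < k := by exact_mod_cast h1
  have h4 : k < a + 1 := by exact_mod_cast h2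
  omega

/-- In the frame `(X, σ, Y, τ)` the ball is at `(ξ, v)` and moves in the direction `(1, S)`. -/
structure InFrame (s : State) (X σ Y τ : ℤ) (S ξ v : ℝ) : Prop where
  hσ : σ = 1 ∨ σ = -1
  hτ : τ = 1 ∨ τ = -1
  pos : s.pos = ((X : ℝ) + σ * ξ, (Y : ℝ) + τ * v)
  dir : s.dir = ((σ : ℝ), (τ : ℝ) * S)

/-- The brick at `(q, r)` in the frame is present. -/
def Present (s : State) (X σ Y τ q r : ℤ) : Prop := (cell X σ q, cell Y τ r) ∈ s.bricks

/-! ### The three kinds of flight, in local coordinates -/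

section Flights

variable {s : State} {X σ Y τ : ℤ} {S ξ v : ℝ}

theorem InFrame.point (h : InFrame s X σ Y τ S ξ v) (u : ℝ) :
    s.pos + u • s.dir = ((X : ℝ) + σ * (ξ + u), (Y : ℝ) + τ * (v + u * S)) := by
  rw [h.pos, h.dir]
  ext
  · simp; ring
  · simp; ring

theorem InFrame.abs_dir (h : InFrame s X σ Y τ S ξ v) : |s.dir.1| = 1 := by
  rw [h.dir]
  rcases h.hσ with h | h <;> simp [h]

theorem InFrame.exists_cell (h : InFrame s X σ Y τ S ξ v) {w : ℤ × ℤ} (hw : w ∈ s.bricks) {u : ℝ}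
    (hu : s.pos + u • s.dir ∈ brick w) : ∃ q r : ℤ, w = (cell X σ q, cell Y τ r) ∧
      Present s X σ Y τ q r ∧ ((q : ℝ) ≤ ξ + u ∧ ξ + u ≤ q + 1) ∧
      ((r : ℝ) ≤ v + u * S ∧ v + u * S ≤ r + 1) := by
  obtain ⟨c, d⟩ := w
  obtain ⟨q, rfl⟩ := cell_surjective h.hσ X c
  obtain ⟨r, rfl⟩ := cell_surjective h.hτ Y d
  rw [h.point, mem_brick_cell h.hσ h.hτ] at hu
  exact ⟨q, r, rfl, hw, hu⟩

theorem InFrame.avoid (h : InFrame s X σ Y τ S ξ v) {u : ℝ}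
    (hu : (∃ a : ℤ, (a : ℝ) < ξ + u ∧ ξ + u < a + 1) ∨
      ∃ r : ℤ, (r : ℝ) < v + u * S ∧ v + u * S < r + 1) (m n : ℤ) :
    s.pos + u • s.dir ≠ ((m : ℝ), (n : ℝ)) := by
  intro he
  rw [h.point, Prod.mk.injEq] at he
  obtain ⟨k, hk⟩ := int_of_frame h.hσ he.1
  obtain ⟨l, hl⟩ := int_of_frame h.hτ he.2
  rcases hu with ⟨a, h1, h2⟩ | ⟨r, h1, h2⟩
  · exact not_int_of_between h1 h2 hk
  · exact not_int_of_between h1 h2 hl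

/-- A flight inside the row `0` that ends at a vertical edge. The ball may start on the lower
border of the row. -/
theorem InFrame.firstTouch_side (h : InFrame s X σ Y τ S ξ v) {m : ℤ} (hS : 0 < S) (hv : 0 ≤ v)
    (hv' : v + (m - ξ) * S < 1) (hξ : 0 ≤ ξ) (hm : ξ ≤ m) (hm' : ξ < m ∨ 0 < v)
    (hfree : ∀ q, -1 ≤ q → q < m → ¬ Present s X σ Y τ q 0)
    (hstart : v = 0 → ∃ a : ℤ, (a : ℝ) < ξ ∧ ξ < a + 1 ∧ ¬ Present s X σ Y τ a (-1))
    (hend : Present s X σ Y τ m 0) :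
    FirstTouch s (cell X σ m, cell Y τ 0) Letter.b (m - ξ) := by
  have hup : ∀ u, u ≤ m - ξ → v + u * S < 1 := by
    intro u hu
    nlinarith
  have hlow : ∀ u, 0 ≤ u → (0 < u ∨ 0 < v) → 0 < v + u * S := by
    rintro u hu (h | h)
    · have := mul_pos h hS; linarith
    · have := mul_nonneg hu hS.le; linarith
  have hrow : ∀ r : ℤ, ∀ u, 0 < v + u * S → v + u * S < 1 → (r : ℝ) ≤ v + u * S →
      v + u * S ≤ r + 1 → r = 0 := by
    intro r u h1 h2 h3 h4
    have h5 : r < 1 := by exact_mod_cast h3.trans_lt h2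
    have h6 : (0 : ℝ) < r + 1 := h1.trans_le h4
    have h7 : 0 < r + 1 := by exact_mod_cast h6
    omega
  have hcol : ∀ q : ℤ, ∀ u, 0 ≤ u → ξ + u ≤ q + 1 → -1 ≤ q := by
    intro q u h1 h2
    have h3 : (0 : ℝ) ≤ (q : ℝ) + 1 := by linarith
    have h4 : 0 ≤ q + 1 := by exact_mod_cast h3
    omega
  refine ⟨by linarith, ?_, ?_, hend, ?_, ?_⟩
  · intro u hu hut w hw hmem
    obtain ⟨q, r, rfl, hP, ⟨h1, h2⟩, h3, h4⟩ := h.exists_cell hw hmem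
    have hq1 := hcol q u hu h2
    have hq2 : q < m := by
      have : (q : ℝ) < m := by linarith
      exact_mod_cast this
    by_cases hc : 0 < u ∨ 0 < v
    · obtain rfl := hrow r u (hlow u hu hc) (hup u hut.le) h3 h4
      exact hfree q hq1 hq2 hP
    -- Here u = v = 0: the ball is on the lower border and also touches row -1, where `hstart`
    -- supplies the only relevant cell.
    · push Not at hc
      obtain rfl : u = 0 := le_antisymm hc.1 hu
      obtain rfl : v = 0 := le_antisymm hc.2 hv
      obtain ⟨a, ha1, ha2, ha⟩ := hstart rfl
      have hqa : q = a := by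
        have e1 : (q : ℝ) < a + 1 := by linarith
        have e2 : (a : ℝ) < q + 1 := by linarith
        have e3 : q < a + 1 := by exact_mod_cast e1
        have e4 : a < q + 1 := by exact_mod_cast e2
        omega
      have hr : r = 0 ∨ r = -1 := by
        have e1 : (r : ℝ) ≤ 0 := by linarith
        have e2 : (0 : ℝ) ≤ r + 1 := by linarith
        have e3 : r ≤ 0 := by exact_mod_cast e1
        have e4 : 0 ≤ r + 1 := by exact_mod_cast e2
        omega
      rcases hr with rfl | rfl
      · exact hfree q hq1 hq2 hP
      · exact ha (hqa ▸ hP)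
  · intro u hu hut
    apply h.avoid
    by_cases hc : 0 < u ∨ 0 < v
    · right
      exact ⟨0, by simpa using hlow u hu hc, by simpa using hup u hut⟩
    · push Not at hc
      obtain rfl : u = 0 := le_antisymm hc.1 hu
      obtain ⟨a, ha1, ha2, -⟩ := hstart (le_antisymm hc.2 hv)
      left
      exact ⟨a, by simpa using ha1, by simpa using ha2⟩
  · rw [h.point]
    refine ⟨?_, (mem_Icc_cell h.hτ Y 0 _).2 ⟨?_, ?_⟩⟩
    · rw [add_sub_cancel]; exact end_cell h.hσ X m
    · simpa using (hlow (m - ξ) (by linarith) (hm'.imp_left sub_pos.2)).le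
    · simpa using hv'.le
  · intro w hw hmem
    obtain ⟨q, r, rfl, hP, ⟨h1, h2⟩, h3, h4⟩ := h.exists_cell hw hmem
    obtain rfl := hrow r _ (hlow (m - ξ) (by linarith) (hm'.imp_left sub_pos.2)) hv' h3 h4
    have hq1 := hcol q (m - ξ) (by linarith) h2
    have hq2 : q ≤ m := by
      have : (q : ℝ) ≤ m := by linarith
      exact_mod_cast this
    by_cases hqm : q = m
    · rw [hqm]
    · exact absurd hP (hfree q hq1 (by omega))

/-- A flight inside the row `0` that ends at the upper border of the row. -/
theorem InFrame.firstTouch_cross (h : InFrame s X σ Y τ S 0 v) {a : ℤ} {t : ℝ} (hS : 0 < S)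
    (hv : 0 < v) (ht : v + t * S = 1) (ht0 : 0 ≤ t) (ha : (a : ℝ) < t) (ha' : t < a + 1)
    (hfree : ∀ q, -1 ≤ q → q ≤ a → ¬ Present s X σ Y τ q 0)
    (hend : Present s X σ Y τ a 1) :
    FirstTouch s (cell X σ a, cell Y τ 1) Letter.a t := by
  have hup : ∀ u, u < t → v + u * S < 1 := by
    intro u hu
    nlinarith
  have hlow : ∀ u, 0 ≤ u → 0 < v + u * S := by
    intro u hu
    have := mul_nonneg hu hS.le; linarith
  have hcol : ∀ q : ℤ, ∀ u, 0 ≤ u → u ≤ t → (q : ℝ) ≤ 0 + u → 0 + u ≤ q + 1 →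
      -1 ≤ q ∧ q ≤ a := by
    intro q u h1 h2 h3 h4
    have e1 : (0 : ℝ) ≤ (q : ℝ) + 1 := by linarith
    have e2 : 0 ≤ q + 1 := by exact_mod_cast e1
    have e3 : (q : ℝ) < a + 1 := by linarith
    have e4 : q < a + 1 := by exact_mod_cast e3
    omega
  refine ⟨ht0, ?_, ?_, hend, ?_, ?_⟩
  · intro u hu hut w hw hmem
    obtain ⟨q, r, rfl, hP, ⟨h1, h2⟩, h3, h4⟩ := h.exists_cell hw hmem
    obtain ⟨hq1, hq2⟩ := hcol q u hu hut.le h1 h2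
    have hr : r = 0 := by
      have h5 : r < 1 := by exact_mod_cast h3.trans_lt (hup u hut)
      have h6 : (0 : ℝ) < r + 1 := (hlow u hu).trans_le h4
      have h7 : 0 < r + 1 := by exact_mod_cast h6
      omega
    subst hr
    exact hfree q hq1 hq2 hP
  · intro u hu hut
    apply h.avoid
    rcases hut.lt_or_eq with hlt | rfl
    · right
      exact ⟨0, by simpa using hlow u hu, by simpa using hup u hlt⟩
    · left
      exact ⟨a, by simpa using ha, by simpa using ha'⟩
  · rw [h.point]
    refine ⟨(mem_Icc_cell h.hσ X a _).2 ⟨by linarith, by linarith⟩, ?_⟩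
    rw [ht]
    simpa using end_cell h.hτ Y 1
  · intro w hw hmem
    obtain ⟨q, r, rfl, hP, ⟨h1, h2⟩, h3, h4⟩ := h.exists_cell hw hmem
    obtain ⟨hq1, hq2⟩ := hcol q t ht0 le_rfl h1 h2
    have hr : r = 0 ∨ r = 1 := by
      have e1 : (r : ℝ) ≤ 1 := by linarith
      have e2 : (0 : ℝ) ≤ r := by linarith
      have e3 : r ≤ 1 := by exact_mod_cast e1
      have e4 : 0 ≤ r := by exact_mod_cast e2
      omega
    rcases hr with rfl | rfl
    · exact absurd hP (hfree q hq1 hq2)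
    · have hqa : q = a := by
        have e2 : (a : ℝ) < q + 1 := by linarith
        have e4 : a < q + 1 := by exact_mod_cast e2
        omega
      rw [hqa]

/-- A flight through the row `0` and then through a hole of the row `1`, that ends at the
vertical edge next to the hole. -/
theorem InFrame.firstTouch_exit (h : InFrame s X σ Y τ S 0 v) {a : ℤ} {t : ℝ} (hS : 0 < S)
    (hS1 : S < 1) (hv : 0 < v) (ht : v + t * S = 1) (ht0 : 0 ≤ t) (ha : (a : ℝ) < t)
    (ha' : t < a + 1) (hfree : ∀ q, -1 ≤ q → q ≤ a → ¬ Present s X σ Y τ q 0)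
    (hhole : ¬ Present s X σ Y τ a 1) (hend : Present s X σ Y τ (a + 1) 1) :
    FirstTouch s (cell X σ (a + 1), cell Y τ 1) Letter.b (a + 1) := by
  have hlow : ∀ u, 0 ≤ u → 0 < v + u * S := by
    intro u hu
    have := mul_nonneg hu hS.le; linarith
  -- The border is crossed at t > a, so less than one unit of distance remains and the ball rises by
  -- less than S < 1.
  have hup : ∀ u : ℝ, u ≤ a + 1 → v + u * S < 2 := by
    intro u hu
    nlinarith
  have hcases : ∀ q r : ℤ, ∀ u : ℝ, 0 ≤ u → u ≤ a + 1 → Present s X σ Y τ q r → (q : ℝ) ≤ 0 + u →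
      0 + u ≤ q + 1 → (r : ℝ) ≤ v + u * S → v + u * S ≤ r + 1 →
      q = a + 1 ∧ r = 1 ∧ u = a + 1 := by
    intro q r u hu hu' hP h1 h2 h3 h4
    have hq1 : -1 ≤ q := by
      have e1 : (0 : ℝ) ≤ (q : ℝ) + 1 := by linarith
      have e2 : 0 ≤ q + 1 := by exact_mod_cast e1
      omega
    have hq2 : q ≤ a + 1 := by
      have e1 : (q : ℝ) ≤ a + 1 := by linarith
      exact_mod_cast e1
    have hr : r = 0 ∨ r = 1 := by
      have e1 : (r : ℝ) < 2 := h3.trans_lt (hup u hu')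
      have e2 : (0 : ℝ) < r + 1 := (hlow u hu).trans_le h4
      have e3 : r < 2 := by exact_mod_cast e1
      have e4 : 0 < r + 1 := by exact_mod_cast e2
      omega
    rcases hr with rfl | rfl
    · have hut : u ≤ t := by
        push_cast at h4
        by_contra! hlt
        nlinarith
      have hqa : q ≤ a := by
        have e1 : (q : ℝ) < a + 1 := by linarith
        have e2 : q < a + 1 := by exact_mod_cast e1
        omega
      exact absurd hP (hfree q hq1 hqa)
    · have hut : t ≤ u := by
        push_cast at h3
        by_contra! hlt
        nlinarith
      have hqa : a ≤ q := by
        have e1 : (a : ℝ) < q + 1 := by linarith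
        have e2 : a < q + 1 := by exact_mod_cast e1
        omega
      rcases hqa.lt_or_eq with hlt | rfl
      · obtain rfl : q = a + 1 := by omega
        push_cast at h1
        exact ⟨rfl, rfl, by linarith⟩
      · exact absurd hP hhole
  refine ⟨by linarith, ?_, ?_, hend, ?_, ?_⟩
  · intro u hu hut w hw hmem
    obtain ⟨q, r, rfl, hP, ⟨h1, h2⟩, h3, h4⟩ := h.exists_cell hw hmem
    have := (hcases q r u hu hut.le hP h1 h2 h3 h4).2.2
    linarith
  · intro u hu hut
    apply h.avoid
    rcases lt_trichotomy u t with hlt | rfl | hlt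
    · right
      exact ⟨0, by simpa using hlow u hu, by push_cast; nlinarith⟩
    · left
      exact ⟨a, by simpa using ha, by simpa using ha'⟩
    · right
      exact ⟨1, by push_cast; nlinarith, by have := hup u hut; push_cast; linarith⟩
  · rw [h.point]
    have e := end_cell h.hσ X (a + 1)
    push_cast at e
    refine ⟨by rw [zero_add]; exact e, (mem_Icc_cell h.hτ Y 1 _).2 ⟨?_, ?_⟩⟩
    · push_cast; nlinarith
    · have := hup (a + 1) le_rfl; push_cast; linarith
  · intro w hw hmem
    obtain ⟨q, r, rfl, hP, ⟨h1, h2⟩, h3, h4⟩ := h.exists_cell hw hmem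
    obtain ⟨rfl, rfl, -⟩ := hcases q r _ (by linarith) le_rfl hP h1 h2 h3 h4
    rfl

end Flights

/-! ### Local coordinates after a bounce -/

section Reframe

variable {s : State} {X σ Y τ : ℤ} {S ξ v : ℝ}

theorem InFrame.next_side (h : InFrame s X σ Y τ S ξ v) (z : ℤ × ℤ) (m : ℤ) :
    InFrame (nextState s z Letter.b (m - ξ)) (X + σ * m) (-σ) Y τ S 0 (v + (m - ξ) * S) := by
  refine ⟨?_, h.hτ, ?_, ?_⟩
  · rcases h.hσ with rfl | rfl <;> simp
  · simp only [nextState, h.point]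
    ext
    · push_cast; ring
    · rfl
  · simp only [nextState, bounce, h.dir]
    push_cast; rfl

theorem InFrame.next_cross (h : InFrame s X σ Y τ S ξ v) (z : ℤ × ℤ) {t : ℝ}
    (ht : v + t * S = 1) :
    InFrame (nextState s z Letter.a t) X σ (Y + τ) (-τ) S (ξ + t) 0 := by
  refine ⟨h.hσ, ?_, ?_, ?_⟩
  · rcases h.hτ with rfl | rfl <;> simp
  · simp only [nextState, h.point, ht]
    ext
    · rfl
    · push_cast; ring
  · simp only [nextState, bounce, h.dir]
    push_cast; ext
    · rfl
    · ring

theorem InFrame.shift (h : InFrame s X σ Y τ S ξ v) : InFrame s X σ (Y + τ) τ S ξ (v - 1) := by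
  refine ⟨h.hσ, h.hτ, ?_, h.dir⟩
  rw [h.pos]
  ext
  · rfl
  · push_cast; ring

theorem InFrame.next_dist (h : InFrame s X σ Y τ S ξ v) (z : ℤ × ℤ) (e : Letter) (t : ℝ) :
    (nextState s z e t).dist = s.dist + t := by
  simp [nextState, h.abs_dir]

end Reframe

/-! ### Itineraries -/

/-- The data that govern an orbit which climbs from row to row: it enters the row `N` with the
ordinate `V N` above the bottom of the row, then crosses the next three horizontal lines
between the distances `138 (i + 1) - δ N - 1` and `138 (i + 1) - δ N`. -/
structure Itinerary (S : ℝ) where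
  V : ℕ → ℝ
  δ : ℕ → ℤ
  δ_nonneg : ∀ N, 0 ≤ δ N
  δ_le : ∀ N, δ N ≤ 1
  V_pos : ∀ N, 0 < V N
  V_lt : ∀ N, V N < S
  lt_cross : ∀ (N i : ℕ), i < 3 → (i : ℝ) + 1 < V N + S * (138 * (i + 1) - δ N)
  cross_lt : ∀ (N i : ℕ), i < 3 → V N + S * (138 * (i + 1) - δ N) < i + 1 + S
  V_succ : ∀ N, V (N + 1) = V N + S * (414 - δ N) - 3

/-- The horizontal distance between the first side hit in a row and the `k`-th. -/
noncomputable def tri (k : ℕ) : ℝ := (k : ℝ) * (k + 1) / 2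

theorem tri_succ (k : ℕ) : tri (k + 1) = tri k + (k + 1) := by
  simp only [tri]; push_cast; ring

theorem tri_le_tri {k l : ℕ} (h : k ≤ l) : tri k ≤ tri l := by
  have : (k : ℝ) ≤ l := by exact_mod_cast h
  have h0 : (0 : ℝ) ≤ k := Nat.cast_nonneg k
  simp only [tri]
  nlinarith

/-- The displacement of the ball between the first side hit in a row and the `k`-th, measured
in the direction taken after the first one. -/
def disp (k : ℕ) : ℤ := ∑ n ∈ Finset.range k, (-1) ^ n * ((n : ℤ) + 1)

theorem disp_succ (k : ℕ) : disp (k + 1) = disp k + (-1) ^ k * ((k : ℤ) + 1) := by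
  simp [disp, Finset.sum_range_succ]

/-- The sign of the first coordinate of the direction after the first side hit in the row `N`. -/
def sgn (N : ℕ) : ℤ := -(-1) ^ N

theorem sgn_eq (N : ℕ) : sgn N = 1 ∨ sgn N = -1 := by
  rcases neg_one_pow_eq_or ℤ N with h | h <;> simp [sgn, h]

theorem sgn_succ (N : ℕ) : sgn (N + 1) = -sgn N := by simp [sgn, pow_succ]

/-- The ordinate of the lower border of the row in the frame used in the row `N` after `i`
crossings. -/
def rowY (N i : ℕ) : ℤ := N + (i % 2 : ℕ)

/-- The vertical orientation of the frame after `i` crossings. -/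
def rowτ (i : ℕ) : ℤ := (-1) ^ i

theorem cell_row_zero (N i : ℕ) : cell (rowY N i) (rowτ i) 0 = N := by
  rcases Nat.even_or_odd i with h | h
  · simp [rowY, rowτ, h.neg_one_pow, Nat.even_iff.1 h, cell_one]
  · simp [rowY, rowτ, h.neg_one_pow, Nat.odd_iff.1 h, cell_neg_one]

theorem rowY_succ (N i : ℕ) : rowY N (i + 1) = rowY N i + rowτ i := by
  rcases Nat.even_or_odd i with h | h
  · have : (i + 1) % 2 = 1 := by rw [Nat.even_iff] at h; omega
    simp [rowY, rowτ, h.neg_one_pow, Nat.even_iff.1 h, this]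
  · have : (i + 1) % 2 = 0 := by rw [Nat.odd_iff] at h; omega
    simp [rowY, rowτ, h.neg_one_pow, Nat.odd_iff.1 h, this]

theorem rowτ_succ (i : ℕ) : rowτ (i + 1) = -rowτ i := by simp [rowτ, pow_succ]

theorem rowτ_eq (i : ℕ) : rowτ i = 1 ∨ rowτ i = -1 := neg_one_pow_eq_or ℤ i

/-- The sign of the first coordinate of the direction after the `k`-th side hit in a row. -/
def colσ (N k : ℕ) : ℤ := sgn N * (-1) ^ k

theorem colσ_eq (N k : ℕ) : colσ N k = 1 ∨ colσ N k = -1 := by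
  rcases neg_one_pow_eq_or ℤ k with h | h <;> rcases sgn_eq N with h' | h' <;> simp [colσ, h, h']

theorem colσ_succ (N k : ℕ) : colσ N (k + 1) = -colσ N k := by
  simp [colσ, pow_succ]

/-- From a state with the property `P` there is exactly one step; it is of type `e` and leads to
a state with the property `Q`. -/
def Advances (P Q : State → Prop) (e : Letter) : Prop :=
  ∀ s, P s → ∃ z s', Q s' ∧ ∀ z' e' s'', Step s z' e' s'' ↔ z' = z ∧ e' = e ∧ s'' = s'

/-! ### Invariants of the passage through a row, and single steps preserving them -/

namespace Itinerary

variable {S : ℝ} (I : Itinerary S)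

theorem S_pos {S : ℝ} (I : Itinerary S) : 0 < S := (I.V_pos 0).trans (I.V_lt 0)

theorem S_lt_one {S : ℝ} (I : Itinerary S) : S < 1 := by
  have h1 := I.cross_lt 0 0 (by norm_num)
  have h2 : (I.δ 0 : ℝ) ≤ 1 := by exact_mod_cast I.δ_le 0
  have h3 := I.V_pos 0
  have h4 := I.S_pos
  push_cast at h1
  nlinarith

theorem height_lt (N i : ℕ) (hi : i < 3) {T : ℝ} (hT : T ≤ 138 * (i + 1) - I.δ N - 1) :
    I.V N + S * T < i + 1 := by
  have h1 := I.cross_lt N i hi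
  have h2 := mul_le_mul_of_nonneg_left hT I.S_pos.le
  linarith

theorem lt_height (N i : ℕ) (hi : i < 3) {T : ℝ} (hT : 138 * (i + 1) - I.δ N ≤ T) :
    (i : ℝ) + 1 < I.V N + S * T := by
  have h1 := I.lt_cross N i hi
  have h2 := mul_le_mul_of_nonneg_left hT I.S_pos.le
  linarith

/-- The abscissa at which the row `N` is entered, i.e. of the first side hit there. -/
def X : ℕ → ℤ
  | 0 => 0
  | N + 1 => X N - sgn N * (6 + I.δ N)

/-- The horizontal distance at which the first side hit in the row `N` happens. -/
def D : ℕ → ℤ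
  | 0 => 0
  | N + 1 => D N + (414 - I.δ N)

/-- The abscissa of the `k`-th side hit in the row `N`. -/
def colX (N k : ℕ) : ℤ := I.X N + sgn N * disp k

theorem colX_succ (N k : ℕ) : I.colX N (k + 1) = I.colX N k + colσ N k * ((k : ℤ) + 1) := by
  simp only [colX, colσ, disp_succ]; ring

/-- The column of the first brick destroyed in the row `N + 1`. -/
def hole (N : ℕ) : ℤ := cell (I.X N) (sgn N) (-7 - I.δ N)

/-- The bricks that matter, after the `k`-th side hit in the row `N` and `i` crossings. -/
structure Bricks (N k i : ℕ) (B : Set (ℤ × ℤ)) : Prop where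
  -- The ball is at local abscissa 0; the cell -1 behind it has just been emptied, and the next wall
  -- ahead is at k + 1.
  row : ∀ q, (cell (I.colX N k) (colσ N k) q, (N : ℤ)) ∈ B ↔ q < -1 ∨ (k : ℤ) < q
  above : ∀ c r : ℤ, (N : ℤ) + 2 ≤ r → (c, r) ∈ B
  next : ∀ c, (c, (N : ℤ) + 1) ∈ B ↔ i = 0 ∨ c ≠ I.hole N
  -- This is the brick that the second crossing will hit.
  below : i ≤ 1 → (cell (I.X N) (sgn N) (11 - I.δ N), (N : ℤ) - 1) ∈ B

/-- The state after the `k`-th side hit in the row `N`, preceded by `i` crossings. -/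
structure SideState (N k i : ℕ) (s : State) : Prop where
  frame : InFrame s (I.colX N k) (colσ N k) (rowY N i) (rowτ i) S 0 (I.V N + S * tri k - i)
  dist : s.dist = I.D N + tri k
  bricks : I.Bricks N k i s.bricks

/-- The state after the `i`-th crossing in the row `N`, preceded by the `k`-th side hit. -/
structure CrossState (N k i : ℕ) (s : State) : Prop where
  frame : InFrame s (I.colX N k) (colσ N k) (rowY N i) (rowτ i) S ((i - I.V N) / S - tri k) 0
  dist : s.dist = I.D N + (i - I.V N) / S
  bricks : I.Bricks N k i s.bricks
  start : ∃ a : ℤ, (a : ℝ) < (i - I.V N) / S - tri k ∧ (i - I.V N) / S - tri k < a + 1 ∧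
    ¬ Present s (I.colX N k) (colσ N k) (rowY N i) (rowτ i) a (-1)

/-- The empty stretch grows to the cells -1, …, k+1, and the turn at abscissa k+1 acts by q ↦ k - q,
which preserves this stretch. -/
theorem Bricks.remove_side {I : Itinerary S} {N k i : ℕ} {B : Set (ℤ × ℤ)}
    (h : I.Bricks N k i B) :
    I.Bricks N (k + 1) i (B \ {(cell (I.colX N k) (colσ N k) (k + 1), (N : ℤ))}) := by
  refine ⟨?_, ?_, ?_, ?_⟩
  · intro q
    rw [I.colX_succ, colσ_succ, cell_flip (colσ_eq N k), Set.mem_sdiff, h.row,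
      Set.mem_singleton_iff, Prod.mk.injEq, (cell_injective (colσ_eq N k) _).eq_iff]
    push_cast
    omega
  · intro c r hr
    refine ⟨h.above c r hr, ?_⟩
    rw [Set.mem_singleton_iff, Prod.mk.injEq]
    omega
  · intro c
    rw [Set.mem_sdiff, h.next, Set.mem_singleton_iff, Prod.mk.injEq]
    have : ¬ ((N : ℤ) + 1 = N) := by omega
    tauto
  · intro hi
    refine ⟨h.below hi, ?_⟩
    rw [Set.mem_singleton_iff, Prod.mk.injEq]
    omega

theorem Bricks.not_present {I : Itinerary S} {N k i : ℕ} {s : State}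
    (h : I.Bricks N k i s.bricks) {q : ℤ} (h1 : -1 ≤ q) (h2 : q ≤ k) :
    ¬ Present s (I.colX N k) (colσ N k) (rowY N i) (rowτ i) q 0 := by
  rw [Present, cell_row_zero, h.row]
  omega

theorem Bricks.present {I : Itinerary S} {N k i : ℕ} {s : State}
    (h : I.Bricks N k i s.bricks) :
    Present s (I.colX N k) (colσ N k) (rowY N i) (rowτ i) (k + 1) 0 := by
  rw [Present, cell_row_zero, h.row]
  omega

theorem advances_side {N k i : ℕ} (h0 : 0 < I.V N + S * tri k - i)
    (h1 : I.V N + S * tri (k + 1) - i < 1) :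
    Advances (I.SideState N k i) (I.SideState N (k + 1) i) Letter.b := by
  intro s hs
  have hk : (0 : ℝ) ≤ k := Nat.cast_nonneg k
  have hv : I.V N + S * tri k - i + (((k : ℤ) + 1 : ℤ) - 0) * S =
      I.V N + S * tri (k + 1) - i := by
    rw [tri_succ]; push_cast; ring
  have hF := hs.frame.firstTouch_side (m := k + 1) I.S_pos h0.le (hv ▸ h1) le_rfl
    (by push_cast; linarith) (Or.inr h0) (fun q hq hq' => hs.bricks.not_present hq (by omega))
    (fun h => absurd h h0.ne') hs.bricks.present
  refine ⟨_, _, ⟨?_, ?_, ?_⟩, hF.step_iff⟩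
  · rw [I.colX_succ, colσ_succ, ← hv]
    exact hs.frame.next_side _ _
  · rw [hs.frame.next_dist, hs.dist, tri_succ]; push_cast; ring
  · rw [cell_row_zero]
    exact hs.bricks.remove_side

/-- The flight resumed after a crossing starts exactly on the border, at local height 0; the brick
destroyed there leaves the cell below it free. -/
theorem advances_cross_side {N k i : ℕ} (h0 : I.V N + S * tri k ≤ i)
    (h0' : i < I.V N + S * tri (k + 1)) (h1 : I.V N + S * tri (k + 1) < i + 1) :
    Advances (I.CrossState N k i) (I.SideState N (k + 1) i) Letter.b := by
  intro s hs
  have hS := I.S_pos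
  have hv : 0 + (((k : ℤ) + 1 : ℤ) - ((i - I.V N) / S - tri k)) * S =
      I.V N + S * tri (k + 1) - i := by
    rw [tri_succ]; push_cast; field_simp; ring
  have hlt : (i - I.V N) / S - tri k < ((k : ℤ) + 1 : ℤ) := by
    rw [sub_lt_iff_lt_add, div_lt_iff₀ hS]
    rw [tri_succ] at h0'
    push_cast
    linarith
  have hF := hs.frame.firstTouch_side (m := k + 1) hS le_rfl (by rw [hv]; linarith)
    (by rw [sub_nonneg, le_div_iff₀ hS]; linarith) hlt.le (Or.inl hlt)
    (fun q hq hq' => hs.bricks.not_present hq (by omega)) (fun _ => hs.start) hs.bricks.present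
  refine ⟨_, _, ⟨?_, ?_, ?_⟩, hF.step_iff⟩
  · rw [I.colX_succ, colσ_succ, ← hv]
    exact hs.frame.next_side _ _
  · rw [hs.frame.next_dist, hs.dist, tri_succ]; push_cast; ring
  · rw [cell_row_zero]
    exact hs.bricks.remove_side

/-- The brick hit lies above the row at the first crossing and below it at the second, so its
presence and the effect of its removal are left to `hmem`. -/
theorem advances_cross {N k i : ℕ} {a : ℤ} (h0 : 0 < I.V N + S * tri k - i)
    (ha0 : 0 ≤ a) (hak : a ≤ k) (h1 : I.V N + S * (tri k + a) < i + 1)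
    (h2 : i + 1 < I.V N + S * (tri k + a + 1))
    (hmem : ∀ B, I.Bricks N k i B →
      (cell (I.colX N k) (colσ N k) a, cell (rowY N i) (rowτ i) 1) ∈ B ∧
      I.Bricks N k (i + 1)
        (B \ {(cell (I.colX N k) (colσ N k) a, cell (rowY N i) (rowτ i) 1)})) :
    Advances (I.SideState N k i) (I.CrossState N k (i + 1)) Letter.a := by
  intro s hs
  have hS := I.S_pos
  obtain ⟨t, ht⟩ : ∃ t, t = ((i + 1 : ℕ) - I.V N) / S - tri k := ⟨_, rfl⟩
  have htS : I.V N + S * tri k - i + t * S = 1 := by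
    rw [ht]; push_cast; field_simp; ring
  have hat : (a : ℝ) < t := by
    rw [ht, lt_sub_iff_add_lt, lt_div_iff₀ hS]; push_cast; linarith
  have hta : t < a + 1 := by
    rw [ht, sub_lt_iff_lt_add, div_lt_iff₀ hS]; push_cast; linarith
  have hF := hs.frame.firstTouch_cross hS h0 htS
    (le_trans (by exact_mod_cast ha0) hat.le) hat hta
    (fun q hq hq' => hs.bricks.not_present hq (by omega)) (hmem _ hs.bricks).1
  refine ⟨_, _, ⟨?_, ?_, (hmem _ hs.bricks).2, a, ht ▸ hat, ht ▸ hta, ?_⟩, hF.step_iff⟩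
  · rw [rowY_succ, rowτ_succ, ← ht]
    simpa only [zero_add] using hs.frame.next_cross _ htS
  · rw [hs.frame.next_dist, hs.dist, ht]; ring
  · rw [rowY_succ, rowτ_succ, Present]
    -- In the reversed vertical frame, the brick just destroyed lies in row -1.
    have e : cell (rowY N i + rowτ i) (-rowτ i) (-1) = cell (rowY N i) (rowτ i) 1 := by
      have := cell_flip (rowτ_eq i) (rowY N i) 1 (-1)
      simpa using this
    rw [e]
    simp [nextState]

end Itinerary


/-! ### The numerical data of one row: side hits 16, 22 and 28 -/

theorem disp_16 : disp 16 = -8 := by decide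
theorem disp_22 : disp 22 = -11 := by decide
theorem disp_28 : disp 28 = -14 := by decide

theorem colσ_of_even (N : ℕ) {k : ℕ} (hk : Even k) : colσ N k = sgn N := by
  simp [colσ, hk.neg_one_pow]

namespace Itinerary

variable {S : ℝ} (I : Itinerary S)

theorem cell_16 (N : ℕ) (q : ℤ) :
    cell (I.colX N 16) (colσ N 16) q = cell (I.X N) (sgn N) (-8 + q) := by
  rw [colσ_of_even N (by decide), colX, disp_16, cell_shift]

theorem cell_22 (N : ℕ) (q : ℤ) :
    cell (I.colX N 22) (colσ N 22) q = cell (I.X N) (sgn N) (-11 + q) := by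
  rw [colσ_of_even N (by decide), colX, disp_22, cell_shift]

theorem cell_28 (N : ℕ) (q : ℤ) :
    cell (I.colX N 28) (colσ N 28) q = cell (I.X N) (sgn N) (-14 + q) := by
  rw [colσ_of_even N (by decide), colX, disp_28, cell_shift]

/-- The next row is entered at local abscissa -14 + (8 - δ) = -(6 + δ), in the opposite direction.
-/
theorem cell_X_succ (N : ℕ) (q : ℤ) :
    cell (I.X (N + 1)) (sgn (N + 1)) q = cell (I.X N) (sgn N) (-7 - I.δ N - q) := by
  have h := cell_flip (sgn_eq N) (I.X N) (-(6 + I.δ N)) q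
  rw [sgn_succ, X]
  rw [show I.X N - sgn N * (6 + I.δ N) = I.X N + sgn N * -(6 + I.δ N) by ring, h]
  congr 1; ring

theorem δ_real_nonneg (I : Itinerary S) (N : ℕ) : (0 : ℝ) ≤ I.δ N := by exact_mod_cast I.δ_nonneg N

theorem δ_real_le (I : Itinerary S) (N : ℕ) : (I.δ N : ℝ) ≤ 1 := by exact_mod_cast I.δ_le N

theorem height_pos (I : Itinerary S) (N k : ℕ) : 0 < I.V N + S * tri k := by
  have h : 0 ≤ tri k := by unfold tri; positivity
  have := mul_nonneg I.S_pos.le h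
  linarith [I.V_pos N]

theorem tri_height_lt_one (I : Itinerary S) (N : ℕ) {k : ℕ} (hk : k ≤ 16) :
    I.V N + S * tri k < 1 := by
  have h1 := tri_le_tri hk
  have h2 : tri 16 = 136 := by norm_num [tri]
  have := I.height_lt N 0 (by norm_num) (T := tri k) (by
    have := I.δ_real_le N; push_cast; linarith)
  simpa using this

theorem one_lt_tri_height (I : Itinerary S) (N : ℕ) {k : ℕ} (hk : 17 ≤ k) :
    1 < I.V N + S * tri k := by
  have h1 := tri_le_tri hk
  have h2 : tri 17 = 153 := by norm_num [tri]
  have := I.lt_height N 0 (by norm_num) (T := tri k) (by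
    have := I.δ_real_nonneg N; push_cast; linarith)
  simpa using this

theorem tri_height_lt_two (I : Itinerary S) (N : ℕ) {k : ℕ} (hk : k ≤ 22) :
    I.V N + S * tri k < 2 := by
  have h1 := tri_le_tri hk
  have h2 : tri 22 = 253 := by norm_num [tri]
  have := I.height_lt N 1 (by norm_num) (T := tri k) (by
    have := I.δ_real_le N; push_cast; linarith)
  push_cast at this
  linarith

theorem two_lt_tri_height (I : Itinerary S) (N : ℕ) {k : ℕ} (hk : 23 ≤ k) :
    2 < I.V N + S * tri k := by
  have h1 := tri_le_tri hk
  have h2 : tri 23 = 276 := by norm_num [tri]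
  have := I.lt_height N 1 (by norm_num) (T := tri k) (by
    have := I.δ_real_nonneg N; push_cast; linarith)
  push_cast at this
  linarith

theorem tri_height_lt_three (I : Itinerary S) (N : ℕ) {k : ℕ} (hk : k ≤ 28) :
    I.V N + S * tri k < 3 := by
  have h1 := tri_le_tri hk
  have h2 : tri 28 = 406 := by norm_num [tri]
  have := I.height_lt N 2 (by norm_num) (T := tri k) (by
    have := I.δ_real_le N; push_cast; linarith)
  push_cast at this
  linarith

/-! ### Crossings of the borders and passage to the next row -/

theorem Bricks.first_cross {I : Itinerary S} {N : ℕ} {B : Set (ℤ × ℤ)} (h : I.Bricks N 16 0 B) :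
    (cell (I.colX N 16) (colσ N 16) (1 - I.δ N), cell (rowY N 0) (rowτ 0) 1) ∈ B ∧
      I.Bricks N 16 1
        (B \ {(cell (I.colX N 16) (colσ N 16) (1 - I.δ N), cell (rowY N 0) (rowτ 0) 1)}) := by
  have hr : cell (rowY N 0) (rowτ 0) 1 = N + 1 := by simp [rowY, rowτ, cell_one]
  have hc : cell (I.colX N 16) (colσ N 16) (1 - I.δ N) = I.hole N := by
    rw [cell_16, hole]; congr 1; ring
  rw [hr, hc]
  refine ⟨(h.next _).2 (Or.inl rfl), ?_, ?_, ?_, ?_⟩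
  · intro q
    rw [Set.mem_sdiff, h.row, Set.mem_singleton_iff, Prod.mk.injEq]
    omega
  · intro c r hr
    refine ⟨h.above c r hr, ?_⟩
    rw [Set.mem_singleton_iff, Prod.mk.injEq]
    omega
  · intro c
    rw [Set.mem_sdiff, h.next, Set.mem_singleton_iff, Prod.mk.injEq]
    simp
  · intro _
    refine ⟨h.below (by norm_num), ?_⟩
    rw [Set.mem_singleton_iff, Prod.mk.injEq]
    omega

theorem Bricks.second_cross {I : Itinerary S} {N : ℕ} {B : Set (ℤ × ℤ)} (h : I.Bricks N 22 1 B) :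
    (cell (I.colX N 22) (colσ N 22) (22 - I.δ N), cell (rowY N 1) (rowτ 1) 1) ∈ B ∧
      I.Bricks N 22 2
        (B \ {(cell (I.colX N 22) (colσ N 22) (22 - I.δ N), cell (rowY N 1) (rowτ 1) 1)}) := by
  have hr : cell (rowY N 1) (rowτ 1) 1 = (N : ℤ) - 1 := by
    simp only [rowY, rowτ, pow_one, cell_neg_one]; norm_num
  have hc : cell (I.colX N 22) (colσ N 22) (22 - I.δ N) = cell (I.X N) (sgn N) (11 - I.δ N) := by
    rw [cell_22]; congr 1; ring
  rw [hr, hc]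
  refine ⟨h.below le_rfl, ?_, ?_, ?_, ?_⟩
  · intro q
    rw [Set.mem_sdiff, h.row, Set.mem_singleton_iff, Prod.mk.injEq]
    omega
  · intro c r hr
    refine ⟨h.above c r hr, ?_⟩
    rw [Set.mem_singleton_iff, Prod.mk.injEq]
    omega
  · intro c
    rw [Set.mem_sdiff, h.next, Set.mem_singleton_iff, Prod.mk.injEq]
    have : ¬ ((N : ℤ) + 1 = N - 1) := by omega
    simp [this]
  · intro h2
    omega

theorem Bricks.exit {I : Itinerary S} {N : ℕ} {B : Set (ℤ × ℤ)} (h : I.Bricks N 28 2 B) :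
    I.Bricks (N + 1) 0 0
      (B \ {(cell (I.colX N 28) (colσ N 28) (7 - I.δ N + 1), (N : ℤ) + 1)}) := by
  have hd1 := I.δ_nonneg N
  have hd2 := I.δ_le N
  have hd3 := I.δ_nonneg (N + 1)
  have hd4 := I.δ_le (N + 1)
  have hinj := fun q q' => (cell_injective (sgn_eq N) (I.X N)).eq_iff (a := q) (b := q')
  rw [cell_28]
  refine ⟨?_, ?_, ?_, ?_⟩
  · intro q
    have e : cell (I.colX (N + 1) 0) (colσ (N + 1) 0) q =
        cell (I.X N) (sgn N) (-7 - I.δ N - q) := by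
      rw [← cell_X_succ]; simp [colX, colσ, disp]
    rw [e]
    push_cast
    rw [Set.mem_sdiff, h.next, Set.mem_singleton_iff, Prod.mk.injEq, hole, ne_eq, hinj, hinj]
    omega
  · intro c r hr
    push_cast at hr
    refine ⟨h.above c r (by omega), ?_⟩
    rw [Set.mem_singleton_iff, Prod.mk.injEq]
    omega
  · intro c
    push_cast
    refine ⟨fun _ => Or.inl trivial, fun _ => ⟨h.above c _ (by omega), ?_⟩⟩
    rw [Set.mem_singleton_iff, Prod.mk.injEq]
    omega
  · intro _
    rw [cell_X_succ]
    push_cast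
    rw [add_sub_cancel_right]
    refine ⟨?_, ?_⟩
    -- Seen from side hit 28, the required brick has index -4 - δ N + δ (N+1) ≤ -3, beyond the empty
    -- stretch -1, …, 28.
    · have := (h.row (7 - I.δ N - (11 - I.δ (N + 1)))).2 (Or.inl (by omega))
      rw [cell_28] at this
      convert this using 3
      ring
    · rw [Set.mem_singleton_iff, Prod.mk.injEq]
      omega

theorem advances_first_cross (N : ℕ) :
    Advances (I.SideState N 16 0) (I.CrossState N 16 1) Letter.a := by
  have hd1 := I.δ_nonneg N
  have hd2 := I.δ_le N
  have ht : tri 16 = 136 := by norm_num [tri]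
  -- The crossing interval starts at 137 - δ, and `tri 16` = 136; similarly 275 - δ - 253 gives the
  -- column of the second crossing.
  refine I.advances_cross (a := 1 - I.δ N) ?_ (by omega) (by push_cast; omega) ?_ ?_
    fun B hB => hB.first_cross
  · simpa using I.height_pos N 16
  · exact I.height_lt N 0 (by norm_num) (by rw [ht]; push_cast; linarith)
  · exact I.lt_height N 0 (by norm_num) (by rw [ht]; push_cast; linarith)

theorem advances_second_cross (N : ℕ) :
    Advances (I.SideState N 22 1) (I.CrossState N 22 2) Letter.a := by
  have hd1 := I.δ_nonneg N
  have hd2 := I.δ_le N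
  have ht : tri 22 = 253 := by norm_num [tri]
  refine I.advances_cross (a := 22 - I.δ N) ?_ (by omega) (by push_cast; omega) ?_ ?_
    fun B hB => hB.second_cross
  · have := I.one_lt_tri_height N (k := 22) (by norm_num)
    push_cast; linarith
  · exact I.height_lt N 1 (by norm_num) (by rw [ht]; push_cast; linarith)
  · exact I.lt_height N 1 (by norm_num) (by rw [ht]; push_cast; linarith)

/-- The third crossing is in column -14 + (7 - δ) = -7 - δ, the same as the first, -8 + (1 - δ).
This coincidence is the column condition on elementary blocks. -/
theorem advances_exit (N : ℕ) :
    Advances (I.SideState N 28 2) (I.SideState (N + 1) 0 0) Letter.b := by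
  intro s hs
  have hS := I.S_pos
  have hd1 := I.δ_nonneg N
  have hd2 := I.δ_le N
  have ht28 : tri 28 = 406 := by norm_num [tri]
  have hr : cell (rowY N 2) (rowτ 2) 1 = N + 1 := by simp [rowY, rowτ, cell_one]
  have hB := hs.bricks
  obtain ⟨t, ht⟩ : ∃ t, t = (3 - I.V N) / S - tri 28 := ⟨_, rfl⟩
  have hv0 : 0 < I.V N + S * tri 28 - (2 : ℕ) := by
    have := I.two_lt_tri_height N (k := 28) (by norm_num)
    push_cast; linarith
  have htS : I.V N + S * tri 28 - (2 : ℕ) + t * S = 1 := by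
    rw [ht]; push_cast; field_simp; ring
  have hat : ((7 - I.δ N : ℤ) : ℝ) < t := by
    have := I.height_lt N 2 (by norm_num) (T := tri 28 + (7 - I.δ N))
      (by rw [ht28]; push_cast; linarith)
    rw [ht, lt_sub_iff_add_lt, lt_div_iff₀ hS]; push_cast at this ⊢; linarith
  have hta : t < (7 - I.δ N : ℤ) + 1 := by
    have := I.lt_height N 2 (by norm_num) (T := tri 28 + (7 - I.δ N) + 1)
      (by rw [ht28]; push_cast; linarith)
    rw [ht, sub_lt_iff_lt_add, div_lt_iff₀ hS]; push_cast at this ⊢; linarith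
  have ht0 : 0 ≤ t := by
    have : (0 : ℝ) ≤ ((7 - I.δ N : ℤ) : ℝ) := by exact_mod_cast (by omega : 0 ≤ 7 - I.δ N)
    linarith
  have hF := hs.frame.firstTouch_exit hS I.S_lt_one hv0 htS ht0 hat hta
    (fun q hq hq' => hB.not_present hq (by push_cast; omega))
    (by
      rw [Present, hr, hB.next, hole, cell_28]
      push Not
      exact ⟨by norm_num, by congr 1; ring⟩)
    (by
      rw [Present, hr, hB.next, hole, cell_28, ne_eq,
        (cell_injective (sgn_eq N) (I.X N)).eq_iff]
      omega)
  refine ⟨_, _, ⟨?_, ?_, ?_⟩, hF.step_iff⟩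
  -- The ball is now above the border, so the frame also moves up one row.
  · have h := (hs.frame.next_side
      (cell (I.colX N 28) (colσ N 28) (7 - I.δ N + 1), cell (rowY N 2) (rowτ 2) 1)
      (7 - I.δ N + 1)).shift
    convert h using 1
    · congr 1; push_cast; ring
    · rw [colσ_of_even N (by decide)]
      simp only [colX, disp_28, X]
      simp [disp]; ring
    · rw [colσ_of_even N (by decide), ← sgn_succ]
      simp [colσ]
    · simp [rowY, rowτ]
    · simp [rowτ]
    · rw [I.V_succ, ht28]
      simp [tri]; ring
  · rw [hs.frame.next_dist, hs.dist, ht28, D]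
    simp [tri]; ring
  · rw [hr]
    exact hB.exit

theorem advances_start :
    Advances (fun s => s = initialState S (I.V 0)) (I.SideState 0 0 0) Letter.b := by
  rintro s rfl
  have hframe : InFrame (initialState S (I.V 0)) 0 1 0 1 S 0 (I.V 0) :=
    ⟨Or.inl rfl, Or.inl rfl, by simp [initialState], by simp [initialState]⟩
  have hv1 : I.V 0 < 1 := (I.V_lt 0).trans I.S_lt_one
  have hF := hframe.firstTouch_side (m := 0) I.S_pos (I.V_pos 0).le (by simpa using hv1) le_rfl
    (by simp) (Or.inr (I.V_pos 0))
    (fun q h1 h2 => by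
      obtain rfl : q = -1 := by omega
      simp [Present, initialState, cell_one])
    (fun h => absurd h (I.V_pos 0).ne')
    (by simp [Present, initialState, cell_one])
  refine ⟨_, _, ⟨?_, ?_, ?_⟩, hF.step_iff⟩
  · have h := hframe.next_side (cell 0 1 0, cell 0 1 0) 0
    convert h using 1
    · simp [colX, X, disp]
    · simp [colσ, sgn]
    · simp [rowY]
    · simp [rowτ]
    · simp [tri]
  · simp [nextState, initialState, D, tri]
  -- The ball now moves west: the destroyed brick (0,0) is the local cell -1, and the initially
  -- missing brick (-1,0), the local cell 0, plays the part of the hole.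
  · refine ⟨?_, ?_, ?_, ?_⟩
    · intro q
      simp only [nextState, initialState, colX, colσ, X, disp, sgn, cell_one]
      simp [cell_neg_one]
      omega
    · intro c r hr
      simp only [nextState, initialState, cell_one]
      simp
      constructor <;> intros <;> push_cast at hr <;> omega
    · intro c
      simp [nextState, initialState, cell_one]
    · intro _
      simp [nextState, initialState, cell_one]

/-- The state after the `j`-th hit (of any kind) in the row `N`. -/
def LevelState (N j : ℕ) : State → Prop :=
  if j ≤ 16 then I.SideState N j 0
  else if j = 17 then I.CrossState N 16 1
  else if j ≤ 23 then I.SideState N (j - 1) 1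
  else if j = 24 then I.CrossState N 22 2
  else I.SideState N (j - 2) 2

/-- The word `(b¹⁷ a b⁶ a b⁶)^∞`. -/
def _root_.Breakout.word (n : ℕ) : Letter :=
  if n % 31 = 17 ∨ n % 31 = 24 then Letter.a else Letter.b

theorem advances_level (N : ℕ) {j : ℕ} (hj : j < 30) :
    Advances (I.LevelState N j) (I.LevelState N (j + 1))
      (if j + 1 = 17 ∨ j + 1 = 24 then Letter.a else Letter.b) := by
  rcases lt_or_ge j 16 with h | h
  · rw [LevelState, LevelState, if_pos h.le, if_pos (by omega), if_neg (by omega)]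
    exact I.advances_side (by simpa using I.height_pos N j)
      (by simpa using I.tri_height_lt_one N (by omega))
  rcases h.eq_or_lt with rfl | h
  · exact I.advances_first_cross N
  rcases lt_or_ge j 23 with h' | h'
  · rw [if_neg (by omega)]
    rcases (show 17 ≤ j from h).eq_or_lt with rfl | h
    · have h2 : I.V N + S * tri (16 + 1) < 2 := I.tri_height_lt_two N (by norm_num)
      exact I.advances_cross_side
        (by simpa using (I.tri_height_lt_one N le_rfl).le)
        (by simpa using I.one_lt_tri_height N (k := 16 + 1) le_rfl)
        (by push_cast; linarith)
    · obtain ⟨k, rfl⟩ : ∃ k, j = k + 1 := ⟨j - 1, by omega⟩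
      have h1 := I.one_lt_tri_height N (k := k) (by omega)
      have h2 : I.V N + S * tri (k + 1) < 2 := I.tri_height_lt_two N (by omega)
      simp only [LevelState]
      rw [if_neg (by omega), if_neg (by omega), if_pos (by omega), if_neg (by omega),
        if_neg (by omega), if_pos (by omega)]
      exact I.advances_side (by push_cast; linarith) (by push_cast; linarith)
  rcases h'.eq_or_lt with rfl | h'
  · exact I.advances_second_cross N
  rw [if_neg (by omega)]
  rcases (show 24 ≤ j from h').eq_or_lt with rfl | h
  · have h1 : I.V N + S * tri 22 < 2 := I.tri_height_lt_two N (by norm_num)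
    have h2 : 2 < I.V N + S * tri (22 + 1) := I.two_lt_tri_height N (by norm_num)
    have h3 : I.V N + S * tri (22 + 1) < 3 := I.tri_height_lt_three N (by norm_num)
    exact I.advances_cross_side (by push_cast; linarith) (by push_cast; linarith)
      (by push_cast; linarith)
  · obtain ⟨k, rfl⟩ : ∃ k, j = k + 2 := ⟨j - 2, by omega⟩
    have h1 := I.two_lt_tri_height N (k := k) (by omega)
    have h2 : I.V N + S * tri (k + 1) < 3 := I.tri_height_lt_three N (by omega)
    simp only [LevelState]
    rw [if_neg (by omega), if_neg (by omega), if_neg (by omega), if_neg (by omega),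
      if_neg (by omega), if_neg (by omega), if_neg (by omega), if_neg (by omega)]
    exact I.advances_side (by push_cast; linarith) (by push_cast; linarith)

theorem advances_next_level (N : ℕ) :
    Advances (I.LevelState N 30) (I.LevelState (N + 1) 0) Letter.b :=
  I.advances_exit N

/-! ### Existence, determinism and symbolic word of the orbit -/

/-- The state before the `n`-th hit. -/
def StateAt : ℕ → State → Prop
  | 0 => fun s => s = initialState S (I.V 0)
  | n + 1 => I.LevelState (n / 31) (n % 31)

theorem advances_stateAt (n : ℕ) : Advances (I.StateAt n) (I.StateAt (n + 1)) (word n) := by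
  rcases n with _ | n
  · exact I.advances_start
  · simp only [StateAt, word]
    by_cases h : n % 31 = 30
    · rw [show (n + 1) % 31 = 0 by omega, show (n + 1) / 31 = n / 31 + 1 by omega, h]
      exact I.advances_next_level _
    · rw [show (n + 1) % 31 = n % 31 + 1 by omega, show (n + 1) / 31 = n / 31 by omega]
      exact I.advances_level _ (by omega)

theorem nonempty_orbit : Nonempty (Orbit S (I.V 0)) := by
  choose! z s' hQ hstep using I.advances_stateAt
  let f : ℕ → State := fun n => Nat.rec (initialState S (I.V 0)) (fun n s => s' n s) n
  have hf : ∀ n, I.StateAt n (f n) := by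
    intro n
    induction n with
    | zero => rfl
    | succ n ih => exact hQ n _ ih
  exact ⟨⟨f, fun n => z n (f n), word, rfl, fun n => (hstep n _ (hf n) _ _ _).2 ⟨rfl, rfl, rfl⟩⟩⟩

theorem stateAt_orbit (o : Orbit S (I.V 0)) (n : ℕ) : I.StateAt n (o.state n) := by
  induction n with
  | zero => exact o.start
  | succ n ih =>
    obtain ⟨z, s', hQ, hstep⟩ := I.advances_stateAt n _ ih
    rw [((hstep _ _ _).1 (o.step n)).2.2]
    exact hQ

theorem symbolicOrbit_eq (o : Orbit S (I.V 0)) : o.symbolicOrbit = word := by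
  funext n
  obtain ⟨z, s', hQ, hstep⟩ := I.advances_stateAt n _ (I.stateAt_orbit o n)
  exact ((hstep _ _ _).1 (o.step n)).2.1

/-- A row contains 31 hits; the shift by one is due to state 0 preceding every hit. -/
theorem levelState_orbit (o : Orbit S (I.V 0)) (N : ℕ) {j : ℕ} (hj : j < 31) :
    I.LevelState N j (o.state (31 * N + j + 1)) := by
  have h := I.stateAt_orbit o (31 * N + j + 1)
  rw [StateAt, show (31 * N + j) / 31 = N by omega, show (31 * N + j) % 31 = j by omega] at h
  exact h

theorem hasAbscissa_entry (o : Orbit S (I.V 0)) (N : ℕ) : o.HasAbscissa (I.D N) (I.X N) := by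
  have h1 : I.SideState N 0 0 _ := I.levelState_orbit o N (j := 0) (by norm_num)
  have h2 : I.SideState N 1 0 _ := I.levelState_orbit o N (j := 1) (by norm_num)
  refine ⟨31 * N + 0 + 1, ?_, ?_, ?_⟩
  · rw [h1.dist]; simp [tri]
  · rw [h2.dist]; simp [tri]
  · rw [h1.dist, h1.frame.pos]; simp [tri, colX, disp]

/-- The distance 138 - δ lies after the first crossing and before side hit 17, at distance 153, so
it is attained on the flight between them. -/
theorem hasAbscissa_first_cross (o : Orbit S (I.V 0)) (N : ℕ) :
    o.HasAbscissa (I.D N + (138 - I.δ N)) (I.X N - sgn N * (6 + I.δ N)) := by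
  have h1 : I.CrossState N 16 1 _ := I.levelState_orbit o N (j := 17) (by norm_num)
  have h2 : I.SideState N 17 1 _ := I.levelState_orbit o N (j := 18) (by norm_num)
  have ht : tri 16 = 136 := by norm_num [tri]
  have ht' : tri 17 = 153 := by norm_num [tri]
  refine ⟨31 * N + 17 + 1, ?_, ?_, ?_⟩
  · have := I.lt_cross N 0 (by norm_num)
    rw [h1.dist, add_le_add_iff_left, div_le_iff₀ I.S_pos]
    push_cast at this ⊢
    linarith
  · rw [h2.dist, ht']
    have := I.δ_real_nonneg N
    linarith
  · rw [h1.dist, h1.frame.pos, h1.frame.dir, ht, colX, disp_16, colσ_of_even N (by decide)]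
    push_cast; ring

theorem hasAbscissa_second_cross (o : Orbit S (I.V 0)) (N : ℕ) :
    o.HasAbscissa (I.D N + (276 - I.δ N)) (I.X N - sgn N * (-12 + I.δ N)) := by
  have h1 : I.CrossState N 22 2 _ := I.levelState_orbit o N (j := 24) (by norm_num)
  have h2 : I.SideState N 23 2 _ := I.levelState_orbit o N (j := 25) (by norm_num)
  have ht : tri 22 = 253 := by norm_num [tri]
  have ht' : tri 23 = 276 := by norm_num [tri]
  refine ⟨31 * N + 24 + 1, ?_, ?_, ?_⟩
  · have := I.lt_cross N 1 (by norm_num)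
    rw [h1.dist, add_le_add_iff_left, div_le_iff₀ I.S_pos]
    push_cast at this ⊢
    linarith
  · rw [h2.dist, ht']
    have := I.δ_real_nonneg N
    linarith
  · rw [h1.dist, h1.frame.pos, h1.frame.dir, ht, colX, disp_22, colσ_of_even N (by decide)]
    push_cast; ring

end Itinerary


/-! ### Elementary blocks read off an itinerary -/

namespace Itinerary

variable {S : ℝ} (I : Itinerary S)

/-- The elementary block that describes the passage through the row `N`. -/
def block (N : ℕ) : Fin 3 → ℕ × ℕ := if I.δ N = 1 then blockΛ₀ else blockΛ

theorem block_cases (N : ℕ) :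
    (I.δ N = 0 ∧ I.block N = blockΛ) ∨ (I.δ N = 1 ∧ I.block N = blockΛ₀) := by
  have h1 := I.δ_nonneg N
  have h2 := I.δ_le N
  by_cases h : I.δ N = 1
  · exact Or.inr ⟨h, if_pos h⟩
  · exact Or.inl ⟨by omega, if_neg h⟩

theorem len_block (N : ℕ) (i : Fin 3) : (len (I.block N i) : ℤ) = 138 * (i + 1) - I.δ N := by
  rcases I.block_cases N with ⟨h1, h2⟩ | ⟨h1, h2⟩ <;> rw [h1, h2] <;> fin_cases i <;> decide

theorem absc_block (N : ℕ) (i : Fin 3) :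
    absc (I.block N i) = (![6 + I.δ N, -12 + I.δ N, 6 + I.δ N] : Fin 3 → ℤ) i := by
  rcases I.block_cases N with ⟨h1, h2⟩ | ⟨h1, h2⟩ <;> rw [h1, h2] <;> fin_cases i <;> decide

theorem sum_len_block (N : ℕ) :
    ((∑ j ∈ Finset.range N, len (I.block j 2) : ℕ) : ℤ) = I.D N := by
  induction N with
  | zero => rfl
  | succ N ih =>
    rw [Finset.sum_range_succ, Nat.cast_add, ih, len_block, D]
    simp

theorem sign_block (N : ℕ) :
    (-1 : ℝ) ^ (∑ j ∈ Finset.range N, ((I.block j 2).1 + 1)) = -sgn N := by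
  have h : ∀ j, (I.block j 2).1 + 1 = 29 := by
    intro j
    rcases I.block_cases j with ⟨-, h⟩ | ⟨-, h⟩ <;> rw [h] <;> rfl
  simp only [h, Finset.sum_const, Finset.card_range, smul_eq_mul, sgn]
  rw [mul_comm, pow_mul]
  norm_num

theorem hasElementarySequence (o : Orbit S (I.V 0)) (h : ∀ N, IsElementaryBlock (I.block N)) :
    o.HasElementarySequence I.block := by
  refine ⟨I.V_pos 0, I.V_lt 0, h, fun N i => ?_⟩
  have hD : ((∑ j ∈ Finset.range N, len (I.block j 2) : ℕ) : ℝ) = I.D N := by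
    rw [← sum_len_block]; norm_cast
  have hL : (len (I.block N i) : ℝ) = 138 * ((i : ℕ) + 1) - I.δ N := by
    exact_mod_cast congrArg (Int.cast : ℤ → ℝ) (I.len_block N i)
  rw [Nat.cast_add, hD, hL, sign_block, absc_block]
  refine ⟨I.X N, _, I.hasAbscissa_entry o N, ?_, rfl⟩
  fin_cases i
  · convert I.hasAbscissa_first_cross o N using 1
    · simp
    · simp; ring
  · convert I.hasAbscissa_second_cross o N using 1
    · simp; ring
    · simp; ring
  -- The third distance, 414 - δ, is the length of the whole row: there the ball makes the first
  -- side hit of the next one.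
  · convert I.hasAbscissa_entry o (N + 1) using 1
    · simp [D]; ring
    · simp [X]; ring

end Itinerary

/-! ### The blocks and the slopes of the proposition -/

theorem isElementaryBlock_of_primary {S y : ℝ} {Δ : Fin 3 → ℕ × ℕ}
    (hS : 0 < S) (hS1 : S < 1) (hy : 0 < y) (hyS : y < S) (hΔ : ∀ i, (Δ i).2 < (Δ i).1 + 1)
    (hc : ∀ i : Fin 3, ((i : ℕ) : ℝ) + 1 < y + S * (len (Δ i) : ℝ) ∧
      y + S * (len (Δ i) : ℝ) < ((i : ℕ) : ℝ) + 1 + S)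
    (hpar : (Δ 0).1 ≡ (Δ 2).1 [MOD 2])
    (hcol : ((Δ 2).1 : ℤ) - 2 * (Δ 2).2 = ((Δ 0).1 : ℤ) - 2 * (Δ 0).2) :
    IsElementaryBlock Δ :=
  ⟨⟨hΔ, S, hS, hS1, y, hy, hyS, hc⟩, fun _ => hcol, fun h => absurd hpar h⟩

theorem isElementaryBlock_blockΛ : IsElementaryBlock blockΛ := by
  -- The slope for J = 2, with y the midpoint of (2/827, 3/827).
  refine isElementaryBlock_of_primary (S := 6 / 827) (y := 5 / 1654) (by norm_num) (by norm_num)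
    (by norm_num) (by norm_num) (by decide) (fun i => ?_) (by decide) (by decide)
  fin_cases i <;> norm_num [blockΛ, len]

theorem isElementaryBlock_blockΛ₀ : IsElementaryBlock blockΛ₀ := by
  -- The slope for J = 1, with y the midpoint of (2/413, 3/413).
  refine isElementaryBlock_of_primary (S := 3 / 413) (y := 5 / 826) (by norm_num) (by norm_num)
    (by norm_num) (by norm_num) (by decide) (fun i => ?_) (by decide) (by decide)
  fin_cases i <;> norm_num [blockΛ₀, len]

theorem slices_blockΛ : slices blockΛ = (138, 138, 138) := by decide

theorem slices_blockΛ₀ : slices blockΛ₀ = (137, 138, 138) := by decide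

/-- The slopes of the proposition. -/
noncomputable def slope (J : ℕ) : ℝ := 3 * (J : ℝ) / (3 * (J : ℝ) * 138 - 1)

theorem slope_denom_pos {J : ℕ} (hJ : 1 ≤ J) : (0 : ℝ) < 3 * (J : ℝ) * 138 - 1 := by
  have : (1 : ℝ) ≤ J := by exact_mod_cast hJ
  linarith

theorem slope_height {D : ℝ} (hD : 0 < D) (y r j L : ℝ) :
    y + 3 * r / D + 3 * j / D * L = (y * D + 3 * r + 3 * j * L) / D := by
  field_simp

theorem mod_succ_of_dvd {J N : ℕ} (h : J ∣ N + 1) : N % J + 1 = J := by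
  have hJ : 0 < J := Nat.pos_of_dvd_of_pos h N.succ_pos
  have hlt := Nat.mod_lt N hJ
  by_contra hne
  have h1 : (N + 1) % J = N % J + 1 := by
    rw [Nat.add_mod_eq_add_mod_right 1 (Nat.mod_mod N J).symm]
    exact Nat.mod_eq_of_lt (by omega)
  rw [Nat.mod_eq_zero_of_dvd h] at h1
  omega

theorem mod_succ_of_not_dvd {J N : ℕ} (hJ : 0 < J) (h : ¬ J ∣ N + 1) :
    N % J + 2 ≤ J ∧ (N + 1) % J = N % J + 1 := by
  have hlt := Nat.mod_lt N hJ
  have h1 : (N + 1) % J = (N % J + 1) % J := Nat.add_mod_eq_add_mod_right 1 (Nat.mod_mod N J).symm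
  by_cases he : N % J + 1 = J
  · rw [he, Nat.mod_self] at h1
    exact absurd (Nat.dvd_of_mod_eq_zero h1) h
  · have hlt' : N % J + 1 < J := by omega
    exact ⟨hlt', h1.trans (Nat.mod_eq_of_lt hlt')⟩

/-- The itinerary of the orbit of slope `slope J` launched from `(0, y)`. -/
noncomputable def slopeItinerary (J : ℕ) (hJ : 1 ≤ J) (y : ℝ)
    (hy : 2 / (3 * (J : ℝ) * 138 - 1) < y) (hy' : y < 3 / (3 * (J : ℝ) * 138 - 1)) :
    Itinerary (slope J) where
  V N := y + 3 * (N % J : ℕ) / (3 * (J : ℝ) * 138 - 1)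
  δ N := if J ∣ N + 1 then 1 else 0
  δ_nonneg N := by split_ifs <;> norm_num
  δ_le N := by split_ifs <;> norm_num
  V_pos N := by
    have hD := slope_denom_pos hJ
    have h1 : 0 < 2 / (3 * (J : ℝ) * 138 - 1) := by positivity
    have h2 : 0 ≤ 3 * ((N % J : ℕ) : ℝ) / (3 * (J : ℝ) * 138 - 1) := by positivity
    linarith
  V_lt N := by
    have hD := slope_denom_pos hJ
    have h : ((N % J : ℕ) : ℝ) + 1 ≤ J := by exact_mod_cast Nat.mod_lt N hJ
    rw [lt_div_iff₀ hD] at hy'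
    rw [slope, lt_div_iff₀ hD, add_mul, div_mul_cancel₀ _ hD.ne']
    linarith
  -- After multiplication by D, the case δ = 1 reads yD > 2 - i; the lower bound on y is exactly the
  -- case i = 0.
  lt_cross N i hi := by
    have hD := slope_denom_pos hJ
    have hi' : (i : ℝ) ≤ 2 := by exact_mod_cast Nat.le_of_lt_succ hi
    have hi0 : (0 : ℝ) ≤ i := Nat.cast_nonneg i
    rw [div_lt_iff₀ hD] at hy
    rw [slope, slope_height hD, lt_div_iff₀ hD]
    split_ifs with h
    · have hm : ((N % J : ℕ) : ℝ) + 1 = J := by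
        exact_mod_cast (mod_succ_of_dvd h)
      push_cast
      nlinarith
    · have hm : (0 : ℝ) ≤ ((N % J : ℕ) : ℝ) := Nat.cast_nonneg _
      push_cast
      nlinarith
  -- For δ = 0 the residue is at most J - 2, so yD < 5 - i suffices, and i = 2 uses the full bound
  -- yD < 3.
  cross_lt N i hi := by
    have hD := slope_denom_pos hJ
    have hi' : (i : ℝ) ≤ 2 := by exact_mod_cast Nat.le_of_lt_succ hi
    have hi0 : (0 : ℝ) ≤ i := Nat.cast_nonneg i
    rw [lt_div_iff₀ hD] at hy'
    rw [slope, slope_height hD, div_lt_iff₀ hD, add_mul, div_mul_cancel₀ _ hD.ne']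
    split_ifs with h
    · have hm : ((N % J : ℕ) : ℝ) + 1 = J := by
        exact_mod_cast (mod_succ_of_dvd h)
      push_cast
      nlinarith
    · have hm : ((N % J : ℕ) : ℝ) + 2 ≤ J := by
        exact_mod_cast (mod_succ_of_not_dvd hJ h).1
      push_cast
      nlinarith
  V_succ N := by
    have hD := (slope_denom_pos hJ).ne'
    rw [slope]
    split_ifs with h
    · have hm : ((N % J : ℕ) : ℝ) = J - 1 := by
        rw [eq_sub_iff_add_eq]
        exact_mod_cast (mod_succ_of_dvd h)
      rw [Nat.mod_eq_zero_of_dvd h, hm]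
      push_cast
      field_simp
      ring
    · have hm : (((N + 1) % J : ℕ) : ℝ) = (N % J : ℕ) + 1 := by
        exact_mod_cast (mod_succ_of_not_dvd hJ h).2
      rw [hm]
      push_cast
      field_simp
      ring

theorem slopeItinerary_V_zero (J : ℕ) (hJ : 1 ≤ J) (y : ℝ)
    (hy : 2 / (3 * (J : ℝ) * 138 - 1) < y) (hy' : y < 3 / (3 * (J : ℝ) * 138 - 1)) :
    (slopeItinerary J hJ y hy hy').V 0 = y := by
  simp [slopeItinerary]

theorem slopeItinerary_block (J : ℕ) (hJ : 1 ≤ J) (y : ℝ)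
    (hy : 2 / (3 * (J : ℝ) * 138 - 1) < y) (hy' : y < 3 / (3 * (J : ℝ) * 138 - 1)) :
    (slopeItinerary J hJ y hy hy').block = blockSequence J := by
  funext N
  simp only [Itinerary.block, slopeItinerary, blockSequence]
  by_cases h : J ∣ N + 1 <;> simp [h]

theorem slope_orbits (J : ℕ) (hJ : 1 ≤ J) (y : ℝ)
    (hy : 2 / (3 * (J : ℝ) * 138 - 1) < y) (hy' : y < 3 / (3 * (J : ℝ) * 138 - 1)) :
    Nonempty (Orbit (slope J) y) ∧
      ∀ o : Orbit (slope J) y, o.symbolicOrbit = word ∧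
        o.HasElementarySequence (blockSequence J) := by
  -- The type of orbits depends on y, so the itinerary is made opaque to allow the substitution of
  -- `I.V 0` for y.
  obtain ⟨I, hI⟩ : ∃ I, I = slopeItinerary J hJ y hy hy' := ⟨_, rfl⟩
  have hV : I.V 0 = y := hI ▸ slopeItinerary_V_zero J hJ y hy hy'
  have hB : I.block = blockSequence J := hI ▸ slopeItinerary_block J hJ y hy hy'
  rw [← hB]
  clear hI hB hy hy'
  subst hV
  refine ⟨I.nonempty_orbit, fun o => ⟨I.symbolicOrbit_eq o, I.hasElementarySequence o fun N => ?_⟩⟩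
  rcases I.block_cases N with ⟨-, h⟩ | ⟨-, h⟩ <;> rw [h]
  · exact isElementaryBlock_blockΛ
  · exact isElementaryBlock_blockΛ₀

theorem slope_succ_injective : Function.Injective fun n : ℕ => slope (n + 1) := by
  intro m n h
  have hm := slope_denom_pos (J := m + 1) (by omega)
  have hn := slope_denom_pos (J := n + 1) (by omega)
  simp only [slope] at h
  rw [div_eq_div_iff hm.ne' hn.ne'] at h
  have : (m : ℝ) = n := by push_cast at h; linarith
  exact_mod_cast this

end Breakout

theorem mainTheorem6 :
    (Breakout.IsElementaryBlock Breakout.blockΛ ∧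
      Breakout.slices Breakout.blockΛ = (138, 138, 138)) ∧
    (Breakout.IsElementaryBlock Breakout.blockΛ₀ ∧
      Breakout.slices Breakout.blockΛ₀ = (137, 138, 138)) ∧
    ∃ ω : ℕ → Breakout.Letter,
      (∀ J : ℕ, 1 ≤ J → ∀ y : ℝ,
        2 / (3 * (J : ℝ) * 138 - 1) < y → y < 3 / (3 * (J : ℝ) * 138 - 1) →
          Nonempty (Breakout.Orbit (3 * (J : ℝ) / (3 * (J : ℝ) * 138 - 1)) y) ∧
          ∀ o : Breakout.Orbit (3 * (J : ℝ) / (3 * (J : ℝ) * 138 - 1)) y,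
            o.symbolicOrbit = ω ∧ o.HasElementarySequence (Breakout.blockSequence J)) ∧
      {S : ℝ | 0 < S ∧ S < 1 ∧ ∃ y : ℝ, 0 < y ∧ y < 1 ∧
        ∃ o : Breakout.Orbit S y, o.symbolicOrbit = ω}.Infinite := by
  refine ⟨⟨Breakout.isElementaryBlock_blockΛ, Breakout.slices_blockΛ⟩,
    ⟨Breakout.isElementaryBlock_blockΛ₀, Breakout.slices_blockΛ₀⟩, Breakout.word,
    Breakout.slope_orbits, ?_⟩
  refine (Set.infinite_range_of_injective Breakout.slope_succ_injective).mono ?_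
  rintro _ ⟨n, rfl⟩
  have hJ : 1 ≤ n + 1 := by omega
  have hD := Breakout.slope_denom_pos hJ
  have hn : (1 : ℝ) ≤ (n + 1 : ℕ) := by exact_mod_cast hJ
  obtain ⟨y, hy, hy'⟩ := exists_between (show 2 / (3 * ((n + 1 : ℕ) : ℝ) * 138 - 1) <
    3 / (3 * ((n + 1 : ℕ) : ℝ) * 138 - 1) from div_lt_div_of_pos_right (by norm_num) hD)
  obtain ⟨⟨o⟩, ho⟩ := Breakout.slope_orbits (n + 1) hJ y hy hy'
  have hy0 : 0 < 2 / (3 * ((n + 1 : ℕ) : ℝ) * 138 - 1) := by positivity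
  have hy1 : 3 / (3 * ((n + 1 : ℕ) : ℝ) * 138 - 1) < 1 := by
    rw [div_lt_one hD]; linarith
  refine ⟨?_, ?_, y, hy0.trans hy, hy'.trans hy1, o, (ho o).1⟩
  · exact div_pos (by linarith) hD
  · simp only [Breakout.slope]
    rw [div_lt_one hD]; linarith
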